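/- Let $X$ be a non-empty compact Hausdorff space with its unique compatible uniform structure $\mathscr{U}_X$, let $T$ be a topological semigroup with identity $e$, and let $(T,X)$ be a semiflow, i.e. a jointly continuous map $T\times X\to X$, $(t,x)\mapsto tx$, with $ex=x$ and $t(sx)=(ts)x$ for all $s,t\in T$, $x\in X$. Assume that $(T,X)$ is minimal (the orbit $Tx$ is dense in $X$ for every $x\in X$) and surjective ($tX=X$ for every $t\in T$). Then the following are equivalent: 1. Every point $x\in X$ is almost automorphic, that is: for all nets $\{t_n\}$ in $T$ and $\{x_n'\}$ in $X$ (with the same index set) and all $y,x'\in X$, if $t_nx\to y$, $x_n'\to x'$ and $t_nx_n'=y$ for all $n$, then $x=x'$. 2. $(T,X)$ is equicontinuous and invertible, that is: for every $x\in X$ and $\varepsilon\in\mathscr{U}_X$ there is $\delta\in\mathscr{U}_X$ such that $(x,x')\in\delta$ implies $(tx,tx')\in\varepsilon$ for all $t\in T$; and for each $t\in T$ the map $x\mapsto tx$ is a bijection of $X$ onto itself. 3. $(T,X)$ is almost periodic, that is: for every $\varepsilon\in\mathscr{U}_X$ there is a syndetic set $A\subseteq T$ such that $(x,ax)\in\varepsilon$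 for all $a\in A$ and $x\in X$. Here $A\subseteq T$ is called syndetic if there is a compact set $K\subseteq T$ with $Kt\cap A\neq\emptyset$ for every $t\in T$. -/

import Mathlib

open Filter Topology Uniformity

universe u v

/-- A subset `A` of a topological monoid `T` is (right-)syndetic if there is a compact `K ⊆ T`
such that `K t` meets `A` for every `t ∈ T`. -/
def IsSyndetic {T : Type u} [Monoid T] [TopologicalSpace T] (A : Set T) : Prop :=
  ∃ K : Set T, IsCompact K ∧ ∀ t : T, ∃ k ∈ K, k * t ∈ A

/-- The semiflow is surjective: `tX = X` for every `t`. -/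
def SurjectiveSemiflow (T : Type u) (X : Type v) [Monoid T] [MulAction T X] : Prop :=
  ∀ t : T, Function.Surjective (fun x : X => t • x)

/-- The semiflow is invertible: every transition map `x ↦ t x` is an invertible self-map. -/
def InvertibleSemiflow (T : Type u) (X : Type v) [Monoid T] [MulAction T X] : Prop :=
  ∀ t : T, Function.Bijective (fun x : X => t • x)

/-- The semiflow is equicontinuous: every point of `X` is a point of equicontinuity of the family
of transition maps `x ↦ t x`, `t ∈ T`. -/
def EquicontinuousSemiflow (T : Type u) (X : Type v) [Monoid T] [UniformSpace X]
    [MulAction T X] : Prop :=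
  Equicontinuous (fun (t : T) (x : X) => t • x)

/-- The semiflow is almost periodic: for every entourage `ε` there is a syndetic set `A` in `T`
with `A x ⊆ ε[x]` for all `x ∈ X`. -/
def AlmostPeriodicSemiflow (T : Type u) (X : Type v) [Monoid T] [TopologicalSpace T]
    [UniformSpace X] [MulAction T X] : Prop :=
  ∀ ε ∈ 𝓤 X, ∃ A : Set T, IsSyndetic A ∧ ∀ x : X, ∀ a ∈ A, (x, a • x) ∈ ε

/-- The point `x` is almost automorphic: for all nets `tₙ` in `T` and `x'ₙ` in `X` (indexed by a
common directed set), if `tₙ x → y`, `x'ₙ → x'` and `tₙ x'ₙ = y` for all `n`, then `x = x'`.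
Index sets in `Type (max u v)` suffice to realize every filter on `T × X` by a net. -/
def IsAlmostAutomorphicPoint (T : Type u) {X : Type v} [Monoid T] [TopologicalSpace X]
    [MulAction T X] (x : X) : Prop :=
  ∀ (ι : Type (max u v)) [Preorder ι] [IsDirectedOrder ι] [Nonempty ι]
    (t : ι → T) (x' : ι → X) (y x'' : X),
    Tendsto (fun n => t n • x) atTop (𝓝 y) → Tendsto x' atTop (𝓝 x'') →
    (∀ n, t n • x' n = y) → x = x''

/-- The set of almost automorphic points. -/
def almostAutomorphicPoints (T : Type u) (X : Type v) [Monoid T] [TopologicalSpace X]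
    [MulAction T X] : Set X :=
  {x | IsAlmostAutomorphicPoint T x}

/-! Two mechanisms carry the proof. First, transition maps that are surjective and uniformly
equicontinuous are recurrent: by compactness two powers of `t` are uniformly close, and surjectivity
cancels the smaller one. Hence they cannot bring distant points together, which gives almost
automorphy and almost periodicity. Almost periodicity yields the same non-contraction, since some `k
* t` with `k` in a compact set is near the identity. So the maps are injective with equicontinuous
inverses, and recurrence of the inverses returns equicontinuity.

Second, almost automorphy says that limits of inverses are left inverses of limits. By the
idempotent theorem the Ellis semigroup is then a group, and minimality makes its elements
continuous. A double-limit argument finds an open set where they oscillate little together, and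
minimality with group inverses carries this to every point. -/

section Entourages

/-! ### Recurrence and non-contraction of equicontinuous families -/

variable {X : Type*} [UniformSpace X]

/-- A uniformly equicontinuous family of self-maps of a compact space is totally bounded for
uniform convergence. -/
theorem UniformEquicontinuous.exists_finite_net [CompactSpace X] {ι : Type*} {F : ι → X → X}
    (hF : UniformEquicontinuous F) {ε : Set (X × X)} (hε : ε ∈ 𝓤 X) :
    ∃ J : Set ι, J.Finite ∧ ∀ i, ∃ j ∈ J, ∀ x, (F i x, F j x) ∈ ε := by
  let _ : UniformSpace ι := UniformSpace.comap F (Pi.uniformSpace _)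
  have hpi : IsUniformInducing F := ⟨rfl⟩
  -- Under equicontinuity, uniform and pointwise convergence induce the same uniformity on `ι`; the
  -- pointwise one is totally bounded by Tychonoff.
  have huf := hF.equicontinuous.isUniformInducing_uniformFun_iff_pi.2 hpi
  have htb : TotallyBounded (Set.univ : Set ι) := by
    simpa using totallyBounded_preimage hpi (isCompact_univ.totallyBounded : TotallyBounded _)
  have hmem : {q : ι × ι | ∀ x, (F q.1 x, F q.2 x) ∈ ε} ∈ 𝓤 ι := by
    rw [← huf.comap_uniformity]
    exact ⟨_, (UniformFun.hasBasis_uniformity X X).mem_of_mem hε, fun q hq => hq⟩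
  obtain ⟨J, hJ, hcov⟩ := htb _ hmem
  refine ⟨J, hJ, fun i => ?_⟩
  obtain ⟨j, hj, hij⟩ := Set.mem_iUnion₂.1 (hcov (Set.mem_univ i))
  exact ⟨j, hj, hij⟩

/-- A surjective self-map of a compact space with uniformly equicontinuous iterates is uniformly
recurrent. -/
theorem UniformEquicontinuous.exists_iterate_near_id [CompactSpace X] {f : X → X}
    (hf : UniformEquicontinuous fun n : ℕ => f^[n]) (hs : Function.Surjective f)
    {ε : Set (X × X)} (hε : ε ∈ 𝓤 X) :
    ∃ n : ℕ, ∀ x, (x, f^[n + 1] x) ∈ ε := by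
  obtain ⟨δ, hδ, hsymm, hδε⟩ := comp_symm_mem_uniformity_sets hε
  obtain ⟨J, hJ, hnet⟩ := hf.exists_finite_net hδ
  choose r hr hrδ using hnet
  obtain ⟨m, -, n, -, hmn, he⟩ : ∃ m ∈ Set.univ, ∃ n ∈ Set.univ, m < n ∧ r m = r n :=
    Set.infinite_univ.exists_lt_map_eq_of_mapsTo (fun i _ => hr i) hJ
  obtain ⟨k, rfl⟩ := Nat.exists_eq_add_of_lt hmn
  refine ⟨k, fun x => ?_⟩
  -- Iterates `m` and `m + k + 1` share a net point; writing `x` as an `m`-th iterate cancels the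
  -- common part.
  obtain ⟨z, rfl⟩ := hs.iterate m x
  rw [← Function.iterate_add_apply, show k + 1 + m = m + k + 1 by omega]
  exact hδε ⟨f^[r m] z, hrδ m z, hsymm.symm _ _ (he ▸ hrδ (m + k + 1) z)⟩

/-- If a uniformly equicontinuous family of surjective self-maps of a compact space is closed under
iteration, then its members are uniformly expansive: they cannot bring distant points together. -/
theorem UniformEquicontinuous.exists_entourage_of_iterate [CompactSpace X] {ι : Type*}
    {F : ι → X → X} (hF : UniformEquicontinuous F) (hs : ∀ i, Function.Surjective (F i))
    (hiter : ∀ i n, ∃ j, F j = (F i)^[n]) {ε : Set (X × X)} (hε : ε ∈ 𝓤 X) :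
    ∃ δ ∈ 𝓤 X, ∀ i x x', (F i x, F i x') ∈ δ → (x, x') ∈ ε := by
  obtain ⟨η, hη, hsymm, hηε⟩ := comp_comp_symm_mem_uniformity_sets hε
  refine ⟨_, hF η hη, fun i x x' hx => ?_⟩
  choose σ hσ using hiter i
  obtain ⟨n, hn⟩ := UniformEquicontinuous.exists_iterate_near_id (f := F i)
    (by simpa only [Function.comp_def, hσ] using hF.comp σ) (hs i) hη
  obtain ⟨j, hj⟩ : ∃ j, F j = (F i)^[n] := ⟨σ n, hσ n⟩
  have hx' := hx j
  simp only [hj, ← Function.iterate_succ_apply] at hx'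
  exact hηε ⟨_, ⟨_, hn x, hx'⟩, hsymm.symm _ _ (hn x')⟩

end Entourages

/-! ### A Grothendieck-type double-limit argument -/

section OpenSmallOscillation

/-- Let `f : P → X → Y` be separately continuous, with `P` and `X` compact. Then there is a
nonempty open set in `X` on which all the `f p` have oscillation at most `ε`. -/
theorem exists_isOpen_forall_mem_uniformity {P X Y : Type*} [TopologicalSpace P] [CompactSpace P]
    [TopologicalSpace X] [CompactSpace X] [Nonempty X] [UniformSpace Y] {f : P → X → Y}
    (hl : ∀ x, Continuous fun p => f p x) (hr : ∀ p, Continuous (f p))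
    {ε : Set (Y × Y)} (hε : ε ∈ 𝓤 Y) :
    ∃ V : Set X, IsOpen V ∧ V.Nonempty ∧ ∀ p, ∀ x ∈ V, ∀ x' ∈ V, (f p x, f p x') ∈ ε := by
  obtain ⟨ε₁, hε₁, hε₁s, hε₁ε⟩ := comp_symm_mem_uniformity_sets hε
  obtain ⟨ε₂, hε₂, hε₂ε⟩ := comp_mem_uniformity_sets hε₁
  obtain ⟨η, hη, hηc, hηε⟩ := mem_uniformity_isClosed hε₂
  obtain ⟨δ, hδ, hδc, hδη⟩ := mem_uniformity_isClosed (interior_mem_uniformity hη)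
  by_contra! hno
  -- A state is an open set still available and the finite set of points chosen so far. `key` finds
  -- a new point and two parameters that agree up to `δ` on the old points but not up to `η` at the
  -- new one. Otherwise finitely many parameters would represent all others on `V`, and their
  -- continuity would give the open set denied by `hno`.
  let S := {s : Set X × Finset X // IsOpen s.1 ∧ s.1.Nonempty}
  have key : ∀ s : S, ∃ x ∈ s.1.1, ∃ p p',
      (∀ i ∈ s.1.2, (f p i, f p' i) ∈ δ) ∧ (f p x, f p' x) ∉ η := by
    rintro ⟨⟨V, F⟩, hV, hVne⟩
    by_contra! hall
    obtain ⟨x₁, hx₁⟩ := hVne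
    obtain ⟨J, hJ⟩ := CompactSpace.elim_nhds_subcover
      (fun p : P => {p' | ∀ i ∈ F, (f p i, f p' i) ∈ δ}) fun p =>
        (Filter.eventually_all_finset F).2 fun i _ =>
          (hl i).continuousAt (UniformSpace.ball_mem_nhds (f p i) hδ)
    have hW : ∀ᶠ x in 𝓝 x₁, x ∈ V ∧ ∀ j ∈ J, (f j x₁, f j x) ∈ ε₂ :=
      Filter.Eventually.and (IsOpen.mem_nhds (s := V) hV hx₁)
        ((Filter.eventually_all_finset J).2 fun j _ =>
          (hr j).continuousAt (UniformSpace.ball_mem_nhds (f j x₁) hε₂))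
    obtain ⟨W, hWs, hWo, hxW⟩ := eventually_nhds_iff.1 hW
    obtain ⟨p, x, hx, x', hx', hxx'⟩ := hno W hWo ⟨x₁, hxW⟩
    obtain ⟨j, hjJ, hj⟩ := Set.mem_iUnion₂.1 (hJ.ge (Set.mem_univ p))
    have hclose : ∀ z ∈ W, (f j x₁, f p z) ∈ ε₁ := fun z hz =>
      hε₂ε ⟨f j z, (hWs z hz).2 j hjJ, hηε (hall z (hWs z hz).1 j p hj)⟩
    exact hxx' (hε₁ε ⟨f j x₁, hε₁s.symm _ _ (hclose x hx), hclose x' hx'⟩)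
  choose a ha p p' hpδ hpη using key
  classical
  let next : S → S := fun s =>
    ⟨(s.1.1 ∩ {x | (f (p s) x, f (p' s) x) ∉ η}, insert (a s) s.1.2),
      s.2.1.inter (hηc.isOpen_compl.preimage ((hr _).prodMk (hr _))), a s, ha s, hpη s⟩
  let s : ℕ → S := fun n => next^[n] ⟨(Set.univ, ∅), isOpen_univ, Set.univ_nonempty⟩
  have hsucc : ∀ n, s (n + 1) = next (s n) := fun n => Function.iterate_succ_apply' ..
  have hV : Antitone fun n => (s n).1.1 := antitone_nat_of_succ_le fun n => by
    simp only [hsucc]; exact Set.inter_subset_left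
  have hF : Monotone fun n => (s n).1.2 := monotone_nat_of_le_succ fun n => by
    simp only [hsucc]; exact Finset.subset_insert _ _
  have hnear : ∀ n m, n < m → (f (p (s m)) (a (s n)), f (p' (s m)) (a (s n))) ∈ δ :=
    fun n m h => hpδ (s m) _ (hF (Nat.succ_le_of_lt h) (by
      simp only [Nat.succ_eq_add_one, hsucc]; exact Finset.mem_insert_self _ _))
  have hfar : ∀ n m, n < m → (f (p (s n)) (a (s m)), f (p' (s n)) (a (s m))) ∉ η := by
    intro n m h
    have := hV (Nat.succ_le_of_lt h) (ha (s m))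
    simp only [Nat.succ_eq_add_one, hsucc] at this
    exact this.2
  let U := hyperfilter ℕ
  have hlt : ∀ n, ∀ᶠ m in (U : Filter ℕ), n < m := fun n =>
    (Nat.hyperfilter_le_atTop : (U : Filter ℕ) ≤ atTop) (eventually_gt_atTop n)
  obtain ⟨x, -, hx⟩ := isCompact_univ.ultrafilter_le_nhds (U.map (a ∘ s)) (by simp)
  obtain ⟨q, -, hq⟩ := isCompact_univ.ultrafilter_le_nhds (U.map (p ∘ s)) (by simp)
  obtain ⟨q', -, hq'⟩ := isCompact_univ.ultrafilter_le_nhds (U.map (p' ∘ s)) (by simp)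
  -- Parameters first, then points: the limit pair lies in `δ`. The reverse order, in `h₃`, puts the
  -- same pair outside `interior η ⊇ δ`.
  have h₁ : ∀ n, (f q (a (s n)), f q' (a (s n))) ∈ δ := fun n =>
    hδc.mem_of_tendsto ((((hl _).tendsto q).comp hq).prodMk_nhds (((hl _).tendsto q').comp hq'))
      ((hlt n).mono fun m hm => hnear n m hm)
  have h₂ : (f q x, f q' x) ∈ δ :=
    hδc.mem_of_tendsto ((((hr q).tendsto x).comp hx).prodMk_nhds (((hr q').tendsto x).comp hx))
      (Eventually.of_forall h₁)
  have h₃ : ∀ n, (f (p (s n)) x, f (p' (s n)) x) ∈ (interior η)ᶜ := fun n =>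
    isOpen_interior.isClosed_compl.mem_of_tendsto
      ((((hr _).tendsto x).comp hx).prodMk_nhds (((hr _).tendsto x).comp hx))
      ((hlt n).mono fun m hm h => hfar n m hm (interior_subset h))
  exact isOpen_interior.isClosed_compl.mem_of_tendsto
    ((((hl x).tendsto q).comp hq).prodMk_nhds (((hl x).tendsto q').comp hq'))
    (Eventually.of_forall h₃) (hδη h₂)

end OpenSmallOscillation

/-! ### Equicontinuity versus almost periodicity -/

section Semiflow

variable {T : Type u} {X : Type v} [Monoid T] [MulAction T X]

/-- Almost automorphy may be tested along arbitrary filters on the acting monoid. -/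
theorem IsAlmostAutomorphicPoint.eq_of_tendsto [TopologicalSpace X] {x : X}
    (hx : IsAlmostAutomorphicPoint T x) {F : Filter T} [F.NeBot] {g : T → X} {y z : X}
    (hy : Tendsto (fun t => t • x) F (𝓝 y)) (hz : Tendsto g F (𝓝 z)) (hg : ∀ t, t • g t = y) :
    x = z := by
  -- The standard net of a filter: pointed members of `F` under reverse inclusion.
  let ι := ULift.{v} {q : Set T × T // q.1 ∈ F ∧ q.2 ∈ q.1}
  let _ : Preorder ι := Preorder.lift fun i => OrderDual.toDual i.down.1.1
  have hι : Nonempty ι := by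
    obtain ⟨t, -⟩ := F.nonempty_of_mem univ_mem
    exact ⟨⟨(Set.univ, t), univ_mem, trivial⟩⟩
  have hdir : IsDirectedOrder ι := ⟨fun i j => by
    have hij := inter_mem i.down.2.1 j.down.2.1
    obtain ⟨t, ht⟩ := F.nonempty_of_mem hij
    exact ⟨⟨(_, t), hij, ht⟩, Set.inter_subset_left, Set.inter_subset_right⟩⟩
  have hlim : Tendsto (fun i : ι => i.down.1.2) atTop F := by
    intro A hA
    obtain ⟨t, ht⟩ := F.nonempty_of_mem hA
    exact mem_atTop_sets.2 ⟨⟨(A, t), hA, ht⟩, fun j hj => hj j.down.2.2⟩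
  exact hx ι _ (g ∘ fun i : ι => i.down.1.2) y z (hy.comp hlim) (hz.comp hlim) fun i => hg _

variable [UniformSpace X] [CompactSpace X]

theorem EquicontinuousSemiflow.exists_entourage (he : EquicontinuousSemiflow T X)
    (hs : SurjectiveSemiflow T X) {ε : Set (X × X)} (hε : ε ∈ 𝓤 X) :
    ∃ δ ∈ 𝓤 X, ∀ (t : T) (x x' : X), (t • x, t • x') ∈ δ → (x, x') ∈ ε :=
  (CompactSpace.uniformEquicontinuous_of_equicontinuous he).exists_entourage_of_iterate hs
    (fun t n => ⟨t ^ n, (smul_iterate t n).symm⟩) hε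

/-- All points of an equicontinuous surjective semiflow are almost automorphic. -/
theorem EquicontinuousSemiflow.isAlmostAutomorphicPoint [T2Space X]
    (he : EquicontinuousSemiflow T X) (hs : SurjectiveSemiflow T X) (x : X) :
    IsAlmostAutomorphicPoint T x := by
  intro ι _ _ _ t x' y z hy hz ht
  refine eq_of_uniformity fun {ε} hε => ?_
  obtain ⟨δ, hδ, hδε⟩ := he.exists_entourage hs hε
  obtain ⟨η, hη, hηs, hηδ⟩ := comp_symm_mem_uniformity_sets hδ
  have h₁ : ∀ᶠ n in atTop, (y, t n • x) ∈ η := hy (UniformSpace.ball_mem_nhds y hη)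
  have h₂ := hz (UniformSpace.ball_mem_nhds z
    ((CompactSpace.uniformEquicontinuous_of_equicontinuous he) η hη))
  obtain ⟨n, h₁, h₂⟩ := (h₁.and h₂).exists
  have h₃ : (t n • z, t n • x' n) ∈ η := h₂ (t n)
  rw [ht n] at h₃
  exact hδε (t n) x z (hηδ ⟨y, hηs.symm _ _ h₁, hηs.symm _ _ h₃⟩)

/-- An equicontinuous surjective semiflow on a compact space is almost periodic. -/
theorem EquicontinuousSemiflow.almostPeriodicSemiflow [TopologicalSpace T]
    (he : EquicontinuousSemiflow T X) (hs : SurjectiveSemiflow T X) :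
    AlmostPeriodicSemiflow T X := by
  intro ε hε
  have hu := CompactSpace.uniformEquicontinuous_of_equicontinuous he
  obtain ⟨η, hη, hηs, hηε⟩ := comp_symm_mem_uniformity_sets hε
  obtain ⟨J, hJ, hnet⟩ := hu.exists_finite_net (hu η hη)
  have hrec : ∀ t : T, ∃ n : ℕ, ∀ x : X, (x, t ^ (n + 1) • x) ∈ η := by
    intro t
    obtain ⟨n, hn⟩ := UniformEquicontinuous.exists_iterate_near_id (f := fun x : X => t • x)
      (by simpa only [smul_iterate, Function.comp_def] using hu.comp fun n : ℕ => t ^ n) (hs t) hη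
    exact ⟨n, by simpa only [smul_iterate] using hn⟩
  choose r hr using hrec
  -- If `t` is close to `j`, then `j ^ r j * t` is close to `j ^ (r j + 1)`, which is near the
  -- identity; so finitely many `j ^ r j` suffice.
  refine ⟨{a | ∀ x : X, (x, a • x) ∈ ε},
    ⟨(fun t => t ^ r t) '' J, (hJ.image _).isCompact, fun t => ?_⟩, fun x a ha => ha x⟩
  obtain ⟨j, hj, htj⟩ := hnet t
  refine ⟨_, ⟨j, hj, rfl⟩, fun x => hηε ⟨j ^ (r j + 1) • x, hr j x, hηs.symm _ _ ?_⟩⟩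
  rw [pow_succ, mul_smul, mul_smul]
  exact htj x (j ^ r j)

variable [TopologicalSpace T] [ContinuousSMul T X]

/-- A compact set of a monoid acting continuously on a compact space acts uniformly
equicontinuously. -/
theorem IsCompact.exists_entourage_smul {K : Set T} (hK : IsCompact K) {ε : Set (X × X)}
    (hε : ε ∈ 𝓤 X) :
    ∃ δ ∈ 𝓤 X, ∀ k ∈ K, ∀ x x' : X, (x, x') ∈ δ → (k • x, k • x') ∈ ε := by
  have hcont : Continuous fun q : T × X × X => (q.1 • q.2.1, q.1 • q.2.2) := by fun_prop
  obtain ⟨A, B, -, hB, hKA, hDB, hAB⟩ := generalized_tube_lemma hK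
    (isCompact_range (f := fun x : X => (x, x)) (by fun_prop))
    ((isOpen_interior (s := ε)).preimage hcont) (by
      rintro ⟨k, -⟩ ⟨-, x, rfl⟩
      exact mem_interior_iff_mem_nhds.2 (nhds_le_uniformity (k • x) hε))
  refine ⟨B, ?_, fun k hk x x' hx => interior_subset
    (show ((k, x, x') : T × X × X) ∈ _ from hAB (Set.mk_mem_prod (hKA hk) hx))⟩
  rw [compactSpace_uniformity]
  exact mem_iSup.2 fun x => hB.mem_nhds (hDB ⟨x, rfl⟩)

/-- An almost periodic semiflow on a compact space cannot bring distant points together. -/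
theorem AlmostPeriodicSemiflow.exists_entourage (h : AlmostPeriodicSemiflow T X)
    {ε : Set (X × X)} (hε : ε ∈ 𝓤 X) :
    ∃ δ ∈ 𝓤 X, ∀ (t : T) (x x' : X), (t • x, t • x') ∈ δ → (x, x') ∈ ε := by
  obtain ⟨η, hη, hηs, hηε⟩ := comp_comp_symm_mem_uniformity_sets hε
  obtain ⟨A, ⟨K, hK, hKA⟩, hA⟩ := h η hη
  obtain ⟨δ, hδ, hδη⟩ := hK.exists_entourage_smul hη
  refine ⟨δ, hδ, fun t x x' hx => ?_⟩
  obtain ⟨k, hk, hkt⟩ := hKA t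
  have hm := hδη k hk _ _ hx
  simp only [← mul_smul] at hm
  exact hηε ⟨_, ⟨_, hA x _ hkt, hm⟩, hηs.symm _ _ (hA x' _ hkt)⟩

theorem AlmostPeriodicSemiflow.invertibleSemiflow [T2Space X] (h : AlmostPeriodicSemiflow T X)
    (hs : SurjectiveSemiflow T X) : InvertibleSemiflow T X := by
  refine fun t => ⟨fun x x' hx => eq_of_uniformity fun {ε} hε => ?_, hs t⟩
  obtain ⟨δ, hδ, hδε⟩ := h.exists_entourage hε
  have hx : t • x = t • x' := hx
  exact hδε t x x' (hx ▸ refl_mem_uniformity hδ)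

/-- The inverses of the transition maps of an almost periodic invertible semiflow form a uniformly
equicontinuous family, and hence so do the transition maps. -/
theorem AlmostPeriodicSemiflow.equicontinuousSemiflow (h : AlmostPeriodicSemiflow T X)
    (hi : InvertibleSemiflow T X) : EquicontinuousSemiflow T X := by
  let e : T → X ≃ X := fun t => Equiv.ofBijective _ (hi t)
  have he : ∀ t x, e t x = t • x := fun t x => rfl
  have hinv : UniformEquicontinuous fun (t : T) (x : X) => (e t).symm x := by
    intro ε hε
    obtain ⟨δ, hδ, hδε⟩ := h.exists_entourage hε
    filter_upwards [hδ] with q hq t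
    exact hδε t _ _ (by simpa [← he] using hq)
  refine UniformEquicontinuous.equicontinuous fun ε hε => ?_
  -- Non-contraction of the inverses is uniform equicontinuity of the maps.
  obtain ⟨δ, hδ, hδε⟩ := hinv.exists_entourage_of_iterate (fun t => (e t).symm.surjective)
    (fun t n => ⟨t ^ n, by
      have hl : Function.LeftInverse (e t)^[n] (e t).symm^[n] :=
        Function.LeftInverse.iterate (e t).apply_symm_apply n
      funext x
      rw [Equiv.symm_apply_eq, he, ← smul_iterate_apply]
      exact (hl x).symm⟩) hε
  filter_upwards [hδ] with q hq t
  exact hδε t _ _ (by simpa [← he] using hq)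

end Semiflow

/-! ### The Ellis semigroup under almost automorphy -/

/-- In a compact semigroup of injective self-maps, with the topology of pointwise convergence,
every element has a left inverse. -/
theorem exists_comp_eq_id_of_isClosed {X : Type*} [TopologicalSpace X] [CompactSpace X]
    [T2Space X] {E : Set (X → X)} (hE : IsClosed E) (hcomp : ∀ p ∈ E, ∀ q ∈ E, p ∘ q ∈ E)
    (hinj : ∀ p ∈ E, Function.Injective p) {p : X → X} (hp : p ∈ E) : ∃ q ∈ E, q ∘ p = id := by
  let _ : Semigroup (X → X) := { mul := fun f g => f ∘ g, mul_assoc := fun _ _ _ => rfl }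
  have hcont : ∀ r : X → X, Continuous fun f : X → X => f ∘ r := fun r =>
    continuous_pi fun x => continuous_apply (r x)
  -- The left ideal `E ∘ p` contains an idempotent, and an injective idempotent is the identity.
  obtain ⟨u, ⟨q, hq, rfl⟩, hu⟩ := exists_idempotent_in_compact_subsemigroup hcont
    ((fun f => f ∘ p) '' E) ⟨_, p, hp, rfl⟩ (hE.isCompact.image (hcont p)) (by
      rintro _ ⟨f, hf, rfl⟩ _ ⟨g, hg, rfl⟩
      exact ⟨f ∘ p ∘ g, hcomp _ hf _ (hcomp _ hp _ hg), rfl⟩)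
  refine ⟨q, hq, funext fun x => ?_⟩
  exact hinj _ (hcomp _ hq _ hp) (congrFun hu x)

section AlmostAutomorphic

variable {T : Type u} {X : Type v} [Monoid T] [MulAction T X]

theorem IsAlmostAutomorphicPoint.eq_of_smul_eq [TopologicalSpace X] {x x' : X}
    (hx : IsAlmostAutomorphicPoint T x) {t : T} (h : t • x = t • x') : x = x' :=
  hx PUnit (fun _ => t) (fun _ => x') (t • x) x' tendsto_const_nhds tendsto_const_nhds
    fun _ => h.symm

theorem invertibleSemiflow_of_isAlmostAutomorphicPoint [TopologicalSpace X]
    (hs : SurjectiveSemiflow T X) (haa : ∀ x : X, IsAlmostAutomorphicPoint T x) :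
    InvertibleSemiflow T X :=
  fun t => ⟨fun x _ h => (haa x).eq_of_smul_eq h, hs t⟩

variable [TopologicalSpace X]

/-- The Ellis semigroup of the semiflow: all pointwise limits of transition maps. -/
def ellisSemigroup (T : Type u) (X : Type v) [Monoid T] [MulAction T X] [TopologicalSpace X] :
    Set (X → X) :=
  closure (Set.range fun (t : T) (x : X) => t • x)

/-- The pairs `(p, q)` of self-maps of `X` that are simultaneous pointwise limits of transition
maps and of their inverses. -/
def ellisPairs (hs : SurjectiveSemiflow T X) : Set ((X → X) × (X → X)) :=
  closure (Set.range fun t : T => ((fun x : X => t • x), Function.surjInv (hs t)))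

variable {hs : SurjectiveSemiflow T X}

theorem smul_mem_ellisSemigroup (t : T) : (fun x : X => t • x) ∈ ellisSemigroup T X :=
  subset_closure ⟨t, rfl⟩

theorem comp_mem_ellisSemigroup [ContinuousConstSMul T X] {p q : X → X}
    (hp : p ∈ ellisSemigroup T X) (hq : q ∈ ellisSemigroup T X) : p ∘ q ∈ ellisSemigroup T X := by
  have hsmul : ∀ t : T, ∀ r ∈ ellisSemigroup T X, (fun x => t • r x) ∈ ellisSemigroup T X := by
    intro t r hr
    refine map_mem_closure (f := fun (r : X → X) x => t • r x)
      (continuous_pi fun x => (continuous_apply x).const_smul t) hr ?_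
    rintro _ ⟨s, rfl⟩
    exact ⟨t * s, funext fun x => mul_smul t s x⟩
  have hc : Continuous fun f : X → X => f ∘ q := continuous_pi fun x => continuous_apply (q x)
  rw [ellisSemigroup, ← closure_closure]
  refine map_mem_closure (f := fun f : X → X => f ∘ q) hc hp ?_
  rintro _ ⟨t, rfl⟩
  exact hsmul t q hq

/-- This is almost automorphy of `x` with `y = p x` and `x'ₙ` the chosen preimages of `p x`, which
converge to `q (p x)`. -/
theorem leftInverse_of_mem_ellisPairs (haa : ∀ x : X, IsAlmostAutomorphicPoint T x)
    {p q : X → X} (h : (p, q) ∈ ellisPairs hs) : Function.LeftInverse q p := by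
  intro x
  have : (comap (fun t : T => ((fun x : X => t • x), Function.surjInv (hs t)))
      (𝓝 (p, q))).NeBot := comap_neBot fun A hA => by
    obtain ⟨_, hr, ⟨t, rfl⟩⟩ := mem_closure_iff_nhds.1 h A hA
    exact ⟨t, hr⟩
  have hlim := tendsto_comap (f := fun t : T => ((fun x : X => t • x), Function.surjInv (hs t)))
    (x := 𝓝 (p, q))
  have h₁ := tendsto_pi_nhds.1 ((continuous_fst.tendsto _).comp hlim) x
  have h₂ := tendsto_pi_nhds.1 ((continuous_snd.tendsto _).comp hlim) (p x)
  exact ((haa x).eq_of_tendsto h₁ h₂ fun t => Function.surjInv_eq (hs t) (p x)).symm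

variable [CompactSpace X] [T2Space X]

theorem image_fst_ellisPairs : Prod.fst '' ellisPairs hs = ellisSemigroup T X := by
  rw [ellisPairs, image_closure_of_isCompact isClosed_closure.isCompact continuous_fst.continuousOn,
    ← Set.range_comp]
  rfl

theorem exists_mem_ellisPairs {p : X → X} (hp : p ∈ ellisSemigroup T X) :
    ∃ q, (p, q) ∈ ellisPairs hs := by
  rw [← image_fst_ellisPairs (hs := hs)] at hp
  obtain ⟨⟨p, q⟩, h, rfl⟩ := hp
  exact ⟨q, h⟩

theorem fst_mem_ellisSemigroup {p q : X → X} (h : (p, q) ∈ ellisPairs hs) :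
    p ∈ ellisSemigroup T X := by
  rw [← image_fst_ellisPairs (hs := hs)]
  exact ⟨_, h, rfl⟩

theorem exists_mem_ellisSemigroup_apply_eq (hmin : MulAction.IsMinimal T X) (x z : X) :
    ∃ p ∈ ellisSemigroup T X, p x = z := by
  have h : (fun p : X → X => p x) '' ellisSemigroup T X = Set.univ := by
    rw [ellisSemigroup, image_closure_of_isCompact isClosed_closure.isCompact
      (continuous_apply x).continuousOn, ← Set.range_comp]
    exact (hmin.dense_orbit x).closure_eq
  exact h.ge (Set.mem_univ z)

variable [ContinuousConstSMul T X]

/-- If all points are almost automorphic, then the Ellis semigroup is a group of bijections. -/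
theorem exists_inverse_mem_ellisSemigroup (hs : SurjectiveSemiflow T X)
    (haa : ∀ x : X, IsAlmostAutomorphicPoint T x) {p : X → X} (hp : p ∈ ellisSemigroup T X) :
    ∃ q ∈ ellisSemigroup T X, q ∘ p = id ∧ p ∘ q = id := by
  have key : ∀ r ∈ ellisSemigroup T X, ∃ q ∈ ellisSemigroup T X, q ∘ r = id := fun r hr =>
    exists_comp_eq_id_of_isClosed isClosed_closure
      (fun _ h₁ _ h₂ => comp_mem_ellisSemigroup h₁ h₂)
      (fun f hf => by
        obtain ⟨g, hg⟩ := exists_mem_ellisPairs (hs := hs) hf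
        exact (leftInverse_of_mem_ellisPairs haa hg).injective) hr
  obtain ⟨q, hq, hqp⟩ := key p hp
  obtain ⟨r, hr, hrq⟩ := key q hq
  have hrp : r = p := by rw [← Function.comp_id r, ← hqp, ← Function.comp_assoc, hrq]; rfl
  exact ⟨q, hq, hqp, hrp ▸ hrq⟩

theorem bijective_of_mem_ellisSemigroup (hs : SurjectiveSemiflow T X)
    (haa : ∀ x : X, IsAlmostAutomorphicPoint T x) {p : X → X} (hp : p ∈ ellisSemigroup T X) :
    Function.Bijective p := by
  obtain ⟨q, -, hqp, hpq⟩ := exists_inverse_mem_ellisSemigroup hs haa hp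
  exact ⟨Function.LeftInverse.injective (congrFun hqp),
    Function.RightInverse.surjective (congrFun hpq)⟩

/-- A bijection has only one left inverse, so any partner of `p ∘ q` must be `q' ∘ p'`. -/
theorem comp_mem_ellisPairs (haa : ∀ x : X, IsAlmostAutomorphicPoint T x)
    {p p' q q' : X → X} (hp : (p, p') ∈ ellisPairs hs) (hq : (q, q') ∈ ellisPairs hs) :
    (p ∘ q, q' ∘ p') ∈ ellisPairs hs := by
  have hpq := comp_mem_ellisSemigroup (fst_mem_ellisSemigroup hp) (fst_mem_ellisSemigroup hq)
  obtain ⟨r, hr⟩ := exists_mem_ellisPairs (hs := hs) hpq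
  convert hr using 2
  refine (bijective_of_mem_ellisSemigroup hs haa hpq).2.injective_comp_right ?_
  funext x
  simp only [Function.comp_apply]
  rw [leftInverse_of_mem_ellisPairs haa hp, leftInverse_of_mem_ellisPairs haa hq]
  exact (leftInverse_of_mem_ellisPairs haa hr x).symm

/-- If all points of a minimal surjective semiflow are almost automorphic, then the elements of the
Ellis semigroup are continuous. -/
theorem continuous_of_mem_ellisSemigroup (hmin : MulAction.IsMinimal T X)
    (hs : SurjectiveSemiflow T X) (haa : ∀ x : X, IsAlmostAutomorphicPoint T x) {p : X → X}
    (hp : p ∈ ellisSemigroup T X) : Continuous p := by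
  rw [continuous_iff_ultrafilter]
  intro x U hU
  -- Minimality turns convergence of points `z` into convergence of pairs `c z` sending `x` to `z`.
  -- The limit `r` of `p ∘ (c z).1` may a priori differ from `p ∘ q`, but both have left inverse `q'
  -- ∘ p'`, which is injective; hence `r x = p (q x) = p x`.
  have hlift : ∀ z, ∃ r ∈ ellisPairs hs, r.1 x = z := fun z => by
    obtain ⟨c, hc, hcz⟩ := exists_mem_ellisSemigroup_apply_eq (T := T) hmin x z
    obtain ⟨c', hc'⟩ := exists_mem_ellisPairs (hs := hs) hc
    exact ⟨(c, c'), hc', hcz⟩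
  choose c hc hcx using hlift
  obtain ⟨p', hp'⟩ := exists_mem_ellisPairs (hs := hs) hp
  have hcpt : IsCompact (ellisPairs hs) := isClosed_closure.isCompact
  obtain ⟨⟨q, q'⟩, hq, hqU⟩ := hcpt.ultrafilter_le_nhds (U.map c)
    (tendsto_principal.2 (Eventually.of_forall hc))
  obtain ⟨⟨r, r'⟩, hr, hrU⟩ := hcpt.ultrafilter_le_nhds
    (U.map fun z => (p ∘ (c z).1, (c z).2 ∘ p'))
    (tendsto_principal.2 (Eventually.of_forall fun z => comp_mem_ellisPairs haa hp' (hc z)))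
  have hq₁ : Tendsto (fun z => (c z).1) U (𝓝 q) := (continuous_fst.tendsto _).comp hqU
  have hq₂ : Tendsto (fun z => (c z).2) U (𝓝 q') := (continuous_snd.tendsto _).comp hqU
  have hr₁ : Tendsto (fun z => p ∘ (c z).1) U (𝓝 r) := (continuous_fst.tendsto _).comp hrU
  have hr₂ : Tendsto (fun z => (c z).2 ∘ p') U (𝓝 r') := (continuous_snd.tendsto _).comp hrU
  have hr' : r' = q' ∘ p' := funext fun y =>
    tendsto_nhds_unique (tendsto_pi_nhds.1 hr₂ y) (tendsto_pi_nhds.1 hq₂ (p' y))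
  have hqx : q x = x := by
    refine tendsto_nhds_unique (tendsto_pi_nhds.1 hq₁ x) ?_
    simp only [hcx]
    exact hU
  have hrx : Tendsto p U (𝓝 (r x)) := by
    simpa only [Function.comp_apply, hcx] using tendsto_pi_nhds.1 hr₁ x
  suffices r x = p x from this ▸ hrx
  have h₁ := leftInverse_of_mem_ellisPairs haa (comp_mem_ellisPairs haa hp' hq)
  have h₂ := leftInverse_of_mem_ellisPairs haa hr
  have hbij := bijective_of_mem_ellisSemigroup hs haa
    (comp_mem_ellisSemigroup hp (fst_mem_ellisSemigroup hq))
  have hinv : Function.Injective (q' ∘ p') := (h₁.rightInverse_of_surjective hbij.2).injective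
  refine hinv ?_
  rw [← hr', h₂ x, hr', ← congrArg p hqx]
  exact (h₁ x).symm

end AlmostAutomorphic

/-- A minimal surjective semiflow all of whose points are almost automorphic is equicontinuous. -/
theorem equicontinuousSemiflow_of_isAlmostAutomorphicPoint {T : Type u} {X : Type v} [Monoid T]
    [MulAction T X] [UniformSpace X] [CompactSpace X] [T2Space X] [Nonempty X]
    [ContinuousConstSMul T X] (hmin : MulAction.IsMinimal T X) (hs : SurjectiveSemiflow T X)
    (haa : ∀ x : X, IsAlmostAutomorphicPoint T x) : EquicontinuousSemiflow T X := by
  intro z ε hε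
  have : CompactSpace (ellisSemigroup T X) :=
    isCompact_iff_compactSpace.1 isClosed_closure.isCompact
  obtain ⟨V, hVo, hVne, hV⟩ := exists_isOpen_forall_mem_uniformity
    (f := fun (p : ellisSemigroup T X) (x : X) => p.1 x)
    (fun x => (continuous_apply x).comp continuous_subtype_val)
    (fun p => continuous_of_mem_ellisSemigroup hmin hs haa p.2) hε
  -- Move `z` into `V` by `s`; then `t` acts near `z` as `t ∘ q` acts on `V`, where `q` is the
  -- inverse of `s` in the Ellis semigroup.
  obtain ⟨_, hsz, ⟨s, rfl⟩⟩ := (hmin.dense_orbit z).inter_open_nonempty V hVo hVne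
  obtain ⟨q, hq, hqs, -⟩ :=
    exists_inverse_mem_ellisSemigroup hs haa (smul_mem_ellisSemigroup (X := X) s)
  filter_upwards [(hVo.preimage (continuous_const_smul s)).mem_nhds hsz] with x hx t
  have h := hV ⟨_, comp_mem_ellisSemigroup (smul_mem_ellisSemigroup t) hq⟩ _ hsz _ hx
  have hqs' : ∀ y : X, q (s • y) = y := congrFun hqs
  simpa [hqs'] using h

theorem theorem4p5 (T : Type u) (X : Type v)
    [Monoid T] [TopologicalSpace T] [ContinuousMul T]
    [UniformSpace X] [CompactSpace X] [T2Space X] [Nonempty X]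
    [MulAction T X] [ContinuousSMul T X]
    (hmin : MulAction.IsMinimal T X) (hsurj : SurjectiveSemiflow T X) :
    (almostAutomorphicPoints T X = Set.univ ↔
        EquicontinuousSemiflow T X ∧ InvertibleSemiflow T X) ∧
      (EquicontinuousSemiflow T X ∧ InvertibleSemiflow T X ↔ AlmostPeriodicSemiflow T X) := by
  refine ⟨⟨fun h => ?_, fun h => Set.eq_univ_of_forall fun x =>
    h.1.isAlmostAutomorphicPoint hsurj x⟩, fun h => h.1.almostPeriodicSemiflow hsurj, fun h => ?_⟩
  · have haa : ∀ x : X, IsAlmostAutomorphicPoint T x := Set.eq_univ_iff_forall.1 h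
    exact ⟨equicontinuousSemiflow_of_isAlmostAutomorphicPoint hmin hsurj haa,
      invertibleSemiflow_of_isAlmostAutomorphicPoint hsurj haa⟩
  · have hi := h.invertibleSemiflow hsurj
    exact ⟨h.equicontinuousSemiflow hi, hi⟩
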